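/- **Theorem (maximal concurrency).** Let the set of processes be any set of natural numbers (finite or infinite), ordered as in $\mathbb N$, and let $AE$ be a fixed arbitrary set of processes (those that may be aborted). *States.* A state assigns to every process $p$ a program counter $pc.p\in\mathbb N$ and finite sets of processes $nbh.p$, $prio.p$, $before.p$, $after.p$, $wack.p$, $away.p$, $need.p$, $prom.p$; to every ordered pair $(q,r)$ of processes an integer $fork.q.r$; and, for each of the message types $req, gra, notify, withdraw, ack$, to every ordered pair $(q,r)$ a natural number $m.q.r$ (the number of messages $m$ in transit from $q$ to $r$). Initially all $pc.p=11$, all sets are empty, all $m.q.r=0$, and $fork.q.r=1$ if $r<q$ and $0$ otherwise. *Steps.* The following guarded atomic steps exist; unindexed variables are those of $p$, and what is not mentioned is unchanged. Environment steps of $p$: - $pc=11$: choose any finite set $nbh$ with $p\notin nbh$; $pc:=12$. - $pc=12\wedge p\in AE$: $nbh:=\emptyset$; $pc:=11$. - $pc=13\wedge p\in AE$: $withdraw.p.q$++ for all $q\in nbh$; $wack:=nbh$; $nbh:=\emptyset$; $prio:=\emptyset$; $pc:=11$. - $pc=14\wedge need\cap\{q\mid p<q\}=\emptyset\wedge p\in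 AE$: $gra.p.q$++ and $fork.p.q$-- for all $q\in nbh$ with $p<q$; $withdraw.p.q$++ for all $q\in nbh$; $wack:=nbh$; $need:=\emptyset$; $nbh:=\emptyset$; $pc:=11$. Forward steps of $p$ (together forming the relation $fwd(p)$): - $pc=12\wedge wack=\emptyset$: $notify.p.q$++ for all $q\in nbh$; $prio:=nbh\cap(before\setminus after)$; $pc:=13$. - $pc=13\wedge prio=\emptyset$: $req.p.q$++ for all $q\in nbh$ with $p<q$; $need:=\{q\in nbh\mid p<q\vee q\in away\}$; $pc:=14$. - $pc=14\wedge need=\emptyset$: $withdraw.p.q$++ for all $q\in nbh$; $wack:=nbh$; $pc:=15$. - $pc=15$ (critical section): $pc:=16$. - $pc=16$: $gra.p.q$++ and $fork.p.q$-- for all $q\in nbh$ with $p<q$; $nbh:=\emptyset$; $pc:=11$. Receiving steps of $p$ from $q$ (for each of the seven $m$ named below, the relation $rec(m,q,p)$): - $notify$: if $notify.q.p>0$: $notify.q.p$--; add $q$ to $before$. - $withdraw$: if $withdraw.q.p>0$: $withdraw.q.p$--; remove $q$ from $prio$; add $q$ to $after$. - $after$: if $q\in after\cap before$: remove $q$ from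 $after$ and $before$; $ack.p.q$++. - $ack$: if $ack.q.p>0$: $ack.q.p$--; remove $q$ from $wack$. - $req$: if $req.q.p>0$: $req.q.p$--; add $q$ to $prom$. - $gra$: if $gra.q.p>0$: $gra.q.p$--; $fork.p.q$++; remove $q$ from $away$ and $need$. - $prom$: if $q\in prom\setminus away$ and not ($pc\ge 15$ and $q\in nbh$): $gra.p.q$++; $fork.p.q$--; add $q$ to $away$; remove $q$ from $prom$; if $pc=14$ and $q\in nbh$, add $q$ to $need$. *Executions and fairness.* An execution is an infinite sequence of states $xs(0),xs(1),\dots$ that starts in an initial state and in which any two consecutive states are equal or related by one of the above steps of some process. For sets $P$ of state sequences, $\Box P$ (resp. $\Diamond P$) is the set of sequences all of whose tails (resp. some tail of which) lie in $P$; for a set $U$ of states, $[U]$ is the set of sequences with $xs(0)\in U$; for a relation $R$ on states, $[R]_2$ is the set of sequences with $(xs(0),xs(1))\in R$, and $D(R)=\{x\mid\forall y:(x,y)\notin R\}$. Weak fairness for $R$ is $wf(R)=\Box\Diamond[D(R)]\cup\Box\Diamond[R]_2$. With $Ex$ the set of executions, the set of executions weakly fair for $p$ is $$Wf(p)=Ex\cap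 wf(fwd(p))\cap\bigcap_{q,m}\bigl(wf(rec(m,q,p))\cap wf(rec(m,p,q))\bigr),$$ where $q$ ranges over all processes and $m$ over all seven kinds of receiving steps. Write $p\bowtie q$ ($p$ and $q$ are in conflict) for $q\in nbh.p\wedge p\in nbh.q$. *Claim.* For every process $p$, $$Wf(p)\subseteq\Box\Diamond[pc.p=11]\;\cup\;\bigcup_q\Diamond\Box[p\bowtie q].$$ That is, in every execution weakly fair for $p$, either $p$ is at line 11 infinitely often, or there is a process $q$ such that $p$ and $q$ are in conflict forever from some time onward. -/

import Mathlib

/-! A message passing algorithm for partial mutual exclusion, and the linear time temporal logic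
in which its liveness is expressed. -/

namespace PMX

section Temporal

variable {X : Type*}

/-- The shifted state sequence `D(k, xs)`. -/
def shift (k : ℕ) (xs : ℕ → X) : ℕ → X := fun n => xs (k + n)

/-- `⟦U⟧`: the state sequences that start in the set of states `U`. -/
def sem (U : Set X) : Set (ℕ → X) := {xs | xs 0 ∈ U}

/-- `⟦A⟧₂`: the state sequences whose first two states are related by `A`. -/
def sem₂ (A : X → X → Prop) : Set (ℕ → X) := {xs | A (xs 0) (xs 1)}

/-- `□ Q`: always `Q`. -/
def box (Q : Set (ℕ → X)) : Set (ℕ → X) := {xs | ∀ k, shift k xs ∈ Q}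

/-- `◇ Q`: eventually `Q`. -/
def dia (Q : Set (ℕ → X)) : Set (ℕ → X) := {xs | ∃ k, shift k xs ∈ Q}

/-- The set of states in which no step of the relation `A` is possible. -/
def disabled (A : X → X → Prop) : Set X := {x | ∀ y, ¬ A x y}

/-- Weak fairness for the relation `A`: infinitely often disabled or infinitely often taken. -/
def wf (A : X → X → Prop) : Set (ℕ → X) := box (dia (sem (disabled A))) ∪ box (dia (sem₂ A))

end Temporal

section Algorithm

/-- The global states. `x.v p` is the value of the private variable `v` of process `p`, and
`x.m q r` is the number of messages `m` in transit from `q` to `r`. The (ghost) variable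
`x.fork q r` counts the forks of the edge between `q` and `r` that are held by `q`. -/
@[ext]
structure State (P : Type*) where
  pc : P → ℕ
  nbh : P → Finset P
  prio : P → Finset P
  before : P → Finset P
  after : P → Finset P
  wack : P → Finset P
  away : P → Finset P
  need : P → Finset P
  prom : P → Finset P
  fork : P → P → ℤ
  req : P → P → ℕ
  gra : P → P → ℕ
  notify : P → P → ℕ
  withdraw : P → P → ℕ
  ack : P → P → ℕ

variable {P : Type*} [LinearOrder P]

/-- `for r ∈ S do m.q.r ++ od`. -/
def incr {α : Type*} [Add α] [One α] (m : P → P → α) (q : P) (S : Finset P) : P → P → α :=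
  fun a b => if a = q ∧ b ∈ S then m a b + 1 else m a b

/-- `for r ∈ S do m.q.r -- od`. (On message counters it is only used when they are positive.) -/
def decr {α : Type*} [Sub α] [One α] (m : P → P → α) (q : P) (S : Finset P) : P → P → α :=
  fun a b => if a = q ∧ b ∈ S then m a b - 1 else m a b

/-- The elements of `S` that are higher than `p`. -/
def higher (p : P) (S : Finset P) : Finset P := S.filter (fun q => p < q)

open Function (update)

/-- The initial states: all processes are idle, all sets are empty, no messages are in transit,
and every fork is held by the higher process. -/
def init : Set (State P) :=
  {x | (∀ q, x.pc q = 11) ∧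
    (∀ q, x.nbh q = ∅ ∧ x.prio q = ∅ ∧ x.before q = ∅ ∧ x.after q = ∅ ∧
      x.wack q = ∅ ∧ x.away q = ∅ ∧ x.need q = ∅ ∧ x.prom q = ∅) ∧
    (∀ q r, x.fork q r = if r < q then 1 else 0) ∧
    (∀ q r, x.req q r = 0 ∧ x.gra q r = 0 ∧ x.notify q r = 0 ∧ x.withdraw q r = 0 ∧
      x.ack q r = 0)}

/-! The environment of process `p`; `AE` is the set of the processes that may be aborted. -/

/-- Trigger the idle process `p` with an arbitrary finite neighbourhood. -/
def env11 (p : P) (x y : State P) : Prop :=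
  x.pc p = 11 ∧ ∃ S : Finset P, p ∉ S ∧
    y = { x with
      nbh := update x.nbh p S
      pc := update x.pc p 12 }

/-- Abort at line 12. -/
def env12 (AE : Set P) (p : P) (x y : State P) : Prop :=
  x.pc p = 12 ∧ p ∈ AE ∧
    y = { x with
      nbh := update x.nbh p ∅
      pc := update x.pc p 11 }

/-- Abort at line 13. -/
def env13 (AE : Set P) (p : P) (x y : State P) : Prop :=
  x.pc p = 13 ∧ p ∈ AE ∧
    y = { x with
      withdraw := incr x.withdraw p (x.nbh p)
      wack := update x.wack p (x.nbh p)
      nbh := update x.nbh p ∅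
      prio := update x.prio p ∅
      pc := update x.pc p 11 }

/-- Abort at line 14. -/
def env14 (AE : Set P) (p : P) (x y : State P) : Prop :=
  x.pc p = 14 ∧ higher p (x.need p) = ∅ ∧ p ∈ AE ∧
    y = { x with
      gra := incr x.gra p (higher p (x.nbh p))
      fork := decr x.fork p (higher p (x.nbh p))
      withdraw := incr x.withdraw p (x.nbh p)
      wack := update x.wack p (x.nbh p)
      need := update x.need p ∅
      nbh := update x.nbh p ∅
      pc := update x.pc p 11 }

/-- The steps of the environment of `p`. -/
def env (AE : Set P) (p : P) (x y : State P) : Prop :=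
  env11 p x y ∨ env12 AE p x y ∨ env13 AE p x y ∨ env14 AE p x y

/-! The forward steps of process `p`. -/

def fwd12 (p : P) (x y : State P) : Prop :=
  x.pc p = 12 ∧ x.wack p = ∅ ∧
    y = { x with
      notify := incr x.notify p (x.nbh p)
      prio := update x.prio p (x.nbh p ∩ (x.before p \ x.after p))
      pc := update x.pc p 13 }

def fwd13 (p : P) (x y : State P) : Prop :=
  x.pc p = 13 ∧ x.prio p = ∅ ∧
    y = { x with
      req := incr x.req p (higher p (x.nbh p))
      need := update x.need p ((x.nbh p).filter (fun q => p < q ∨ q ∈ x.away p))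
      pc := update x.pc p 14 }

def fwd14 (p : P) (x y : State P) : Prop :=
  x.pc p = 14 ∧ x.need p = ∅ ∧
    y = { x with
      withdraw := incr x.withdraw p (x.nbh p)
      wack := update x.wack p (x.nbh p)
      pc := update x.pc p 15 }

/-- The critical section. -/
def fwd15 (p : P) (x y : State P) : Prop :=
  x.pc p = 15 ∧ y = { x with pc := update x.pc p 16 }

def fwd16 (p : P) (x y : State P) : Prop :=
  x.pc p = 16 ∧
    y = { x with
      gra := incr x.gra p (higher p (x.nbh p))
      fork := decr x.fork p (higher p (x.nbh p))
      nbh := update x.nbh p ∅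
      pc := update x.pc p 11 }

/-- The forward steps of `p`. -/
def fwd (p : P) (x y : State P) : Prop :=
  fwd12 p x y ∨ fwd13 p x y ∨ fwd14 p x y ∨ fwd15 p x y ∨ fwd16 p x y

/-- The five message types, and the two alternatives of the receiving component that are treated
as if they correspond to messages. -/
inductive Msg
  | notify
  | withdraw
  | after
  | ack
  | req
  | gra
  | prom

/-- `recv m q p`: the steps in which process `p` receives message `m` from `q`. -/
def recv (m : Msg) (q p : P) (x y : State P) : Prop :=
  match m with
  | .notify => 0 < x.notify q p ∧
      y = { x with
        notify := decr x.notify q {p}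
        before := update x.before p (insert q (x.before p)) }
  | .withdraw => 0 < x.withdraw q p ∧
      y = { x with
        withdraw := decr x.withdraw q {p}
        prio := update x.prio p ((x.prio p).erase q)
        after := update x.after p (insert q (x.after p)) }
  | .after => q ∈ x.after p ∩ x.before p ∧
      y = { x with
        after := update x.after p ((x.after p).erase q)
        before := update x.before p ((x.before p).erase q)
        ack := incr x.ack p {q} }
  | .ack => 0 < x.ack q p ∧
      y = { x with
        ack := decr x.ack q {p}
        wack := update x.wack p ((x.wack p).erase q) }
  | .req => 0 < x.req q p ∧
      y = { x with
        req := decr x.req q {p}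
        prom := update x.prom p (insert q (x.prom p)) }
  | .gra => 0 < x.gra q p ∧
      y = { x with
        gra := decr x.gra q {p}
        fork := incr x.fork p {q}
        away := update x.away p ((x.away p).erase q)
        need := update x.need p ((x.need p).erase q) }
  | .prom => q ∈ x.prom p \ x.away p ∧ ¬ (15 ≤ x.pc p ∧ q ∈ x.nbh p) ∧
      y = { x with
        gra := incr x.gra p {q}
        fork := decr x.fork p {q}
        away := update x.away p (insert q (x.away p))
        prom := update x.prom p ((x.prom p).erase q)
        need := if x.pc p = 14 ∧ q ∈ x.nbh p
          then update x.need p (insert q (x.need p)) else x.need }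

/-- The step relation of the system; it is reflexive. -/
def step (AE : Set P) (x y : State P) : Prop :=
  x = y ∨ ∃ p, env AE p x y ∨ fwd p x y ∨ ∃ q m, recv m q p x y

/-- The executions of the algorithm. -/
def Ex (AE : Set P) : Set (ℕ → State P) := sem init ∩ box (sem₂ (step AE))

/-- The executions that are weakly fair for `p`. -/
def Wf (AE : Set P) (p : P) : Set (ℕ → State P) :=
  Ex AE ∩ wf (fwd p) ∩ ⋂ (q : P) (m : Msg), wf (recv m q p) ∩ wf (recv m p q)

/-- The states in which `p` is at line `k`. -/
def at_ (p : P) (k : ℕ) : Set (State P) := {x | x.pc p = k}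

/-- The states with `p ⋈ q`: processes `p` and `q` are in conflict. -/
def conflict (p q : P) : Set (State P) := {x | q ∈ x.nbh p ∧ p ∈ x.nbh q}

end Algorithm

end PMX

/-!
A process `p` that is idle only finitely often runs forward along its program without ever returning
to line 11, so it is eventually stuck at one line, and by weak fairness its forward step is disabled
infinitely often (`exists_pc_eq`, `frequently_disabled_fwd`). Lines 15 and 16 have no guard. Hence
`p` waits at line 12 for `wack` to become empty, at line 13 for `prio`, or at line 14 for `need`.
By the pigeonhole principle a single process `q` keeps `p` waiting: forever in `wack` or `prio`, or
infinitely often in `need`. Fairness is available for the messages between `p` and `q` only, so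
`q` itself need not make progress; two families of invariants, `PriorityInv` and `ForkInv`, locate
the messages on which each wait depends.

* At line 12 (`exists_notMem_wack`), `q` in `wack` means that a withdrawal of `p` is in transit, is
  recorded in `after` at `q`, or is being acknowledged. The corresponding notification is
  in transit or is recorded in `before`, so that the acknowledgement eventually arrives, and this
  wait ends.
* At line 13 (`conflict_of_mem_prio`), `q` in `prio` means that `q` has notified `p` and that its
  withdrawal has not arrived at `p`. A withdrawal in transit would arrive, so `q` has not withdrawn
  and still has `p` as a neighbour.
* At line 14 (`conflict_of_frequently_mem_need`), the notification of `p` is eventually recorded at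
  `q` and stays there. From then on `q` gives priority to `p` whenever it passes line 12 with `p` as
  a neighbour, and so it does not reach line 14 with `p` as a neighbour any more once it has left
  its present attempt: it *yields* to `p` (`Yields`). Either `q` never yields,
  and then the conflict is permanent (`yields_or_mem_nbh`), or `q` yields forever. In the latter
  case, the fork of the edge ends up at `p`: a higher `q` grants it
  (`exists_notMem_need_of_lt`), and a lower `q` returns it and does not request it again
  (`eventually_notMem_need_of_gt`). So `q` is in `need` only finitely often, a contradiction.
-/

namespace PMX

open Filter

/-! ### Linear time temporal logic -/

section Temporal
variable {X : Type*} {xs : ℕ → X}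

theorem mem_box_dia_sem {U : Set X} :
    xs ∈ box (dia (sem U)) ↔ ∃ᶠ n in atTop, xs n ∈ U := by
  simp only [box, dia, sem, shift, Set.mem_ofPred_eq, frequently_atTop]
  refine forall_congr' fun n => ⟨fun ⟨k, hk⟩ => ⟨n + (k + 0), by omega, hk⟩, fun ⟨m, hm, h⟩ => ?_⟩
  exact ⟨m - n, by rwa [show n + (m - n + 0) = m by omega]⟩

theorem mem_box_dia_sem₂ {A : X → X → Prop} :
    xs ∈ box (dia (sem₂ A)) ↔ ∃ᶠ n in atTop, A (xs n) (xs (n + 1)) := by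
  simp only [box, dia, sem₂, shift, Set.mem_ofPred_eq, frequently_atTop]
  refine forall_congr' fun n => ⟨fun ⟨k, hk⟩ => ⟨n + (k + 0), by omega, hk⟩, fun ⟨m, hm, h⟩ => ?_⟩
  refine ⟨m - n, ?_⟩
  rwa [show n + (m - n + 0) = m by omega, show n + (m - n + 1) = m + 1 by omega]

theorem mem_dia_box_sem {U : Set X} :
    xs ∈ dia (box (sem U)) ↔ ∃ N, ∀ n ≥ N, xs n ∈ U := by
  simp only [box, dia, sem, shift, Set.mem_ofPred_eq]
  refine exists_congr fun N => ⟨fun h n hn => ?_, fun h k => h _ (by omega)⟩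
  have := h (n - N)
  rwa [show N + (n - N + 0) = n by omega] at this

/-- The basic progress rule of weak fairness: a condition that enables `A`, and that can be
falsified by `A` only, leads to a step of `A`. -/
theorem exists_step_of_wf {A : X → X → Prop} (hw : xs ∈ wf A) {B : X → Prop} {n : ℕ} (hn : B (xs n))
    (hB : ∀ m ≥ n, B (xs m) → A (xs m) (xs (m + 1)) ∨ B (xs (m + 1)))
    (hA : ∀ m ≥ n, B (xs m) → xs m ∉ disabled A) : ∃ m ≥ n, A (xs m) (xs (m + 1)) := by
  by_contra! hno
  have hall : ∀ m ≥ n, B (xs m) := fun m hm =>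
    Nat.le_induction hn (fun k hk hBk => (hB k hk hBk).resolve_left (hno k hk)) m hm
  rcases hw with h | h
  · obtain ⟨m, hm, hd⟩ := frequently_atTop.1 (mem_box_dia_sem.1 h) n
    exact hA m hm (hall m hm) hd
  · obtain ⟨m, hm, hd⟩ := frequently_atTop.1 (mem_box_dia_sem₂.1 h) n
    exact hno m hm hd

/-- Pigeonhole over a finite set of processes. -/
theorem exists_frequently_mem {P : Type*} {S : ℕ → Finset P} {F : Finset P}
    (hF : ∀ᶠ n in atTop, S n ⊆ F) (hS : ∃ᶠ n in atTop, (S n).Nonempty) :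
    ∃ q, ∃ᶠ n in atTop, q ∈ S n := by
  by_contra! h
  have hall : ∀ᶠ n in atTop, ∀ q ∈ F, q ∉ S n := (eventually_all_finset F).2 fun q _ => h q
  obtain ⟨n, ⟨q, hq⟩, hF, hn⟩ := (hS.and_eventually (hF.and hall)).exists
  exact hn q (hF hq) hq

/-- If no element ever enters `S`, an element that is infinitely often in `S` is always in `S`. -/
theorem mem_of_frequently_mem {P : Type*} {S : ℕ → Finset P} {q : P} {N : ℕ}
    (hS : ∀ n ≥ N, q ∉ S n → q ∉ S (n + 1)) (hq : ∃ᶠ n in atTop, q ∈ S n) :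
    ∀ n ≥ N, q ∈ S n := by
  intro n hn
  by_contra hqn
  obtain ⟨m, hm, hqm⟩ := frequently_atTop.1 hq n
  exact Nat.le_induction hqn (fun k hk h => hS k (hn.trans hk) h) m hm hqm

theorem exists_forall_mem {P : Type*} {S : ℕ → Finset P} {N : ℕ}
    (hS : ∀ n ≥ N, ∀ q, q ∉ S n → q ∉ S (n + 1)) (hne : ∃ᶠ n in atTop, (S n).Nonempty) :
    ∃ q, ∀ n ≥ N, q ∈ S n := by
  have hsub : ∀ n ≥ N, S n ⊆ S N := fun n hn =>
    Nat.le_induction subset_rfl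
      (fun k hk h q hq => h (by_contra fun hqk => hS k hk q hqk hq)) n hn
  obtain ⟨q, hq⟩ := exists_frequently_mem (eventually_atTop.2 ⟨N, hsub⟩) hne
  exact ⟨q, mem_of_frequently_mem (fun n hn => hS n hn q) hq⟩

end Temporal

variable {P : Type*} [LinearOrder P] {AE : Set P} {x y : State P} {p q : P} {xs : ℕ → State P}

/-! ### Invariants -/

/-- Invariants of the priority layer, in which processes exchange `notify`, `withdraw` and `ack`.
The two counting clauses say that a conversation from `p` to `q` is always in one definite stage:
a pending acknowledgement of a withdrawal is represented by exactly one of a `withdraw` message, an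
element of `after`, and an `ack` message, and every notification is represented by exactly one of a
`notify` message and an element of `before` until its withdrawal has been processed. -/
structure PriorityInv (x : State P) : Prop where
  pc_mem : ∀ p, 11 ≤ x.pc p ∧ x.pc p ≤ 16
  wack_empty : ∀ p, x.pc p = 13 ∨ x.pc p = 14 → x.wack p = ∅
  wack_count : ∀ p q, x.withdraw p q + (if p ∈ x.after q then 1 else 0) + x.ack q p =
    if q ∈ x.wack p then 1 else 0
  before_count : ∀ p q, x.notify p q + (if p ∈ x.before q then 1 else 0) =
    (if (x.pc p = 13 ∨ x.pc p = 14) ∧ q ∈ x.nbh p then 1 else 0) + x.withdraw p q +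
      (if p ∈ x.after q then 1 else 0)
  prio_sub : ∀ p q, q ∈ x.prio p →
    x.pc p = 13 ∧ q ∈ x.nbh p ∧ q ∈ x.before p ∧ q ∉ x.after p

/-- Invariants of the fork layer, in which processes exchange `req` and `gra`. Forks are requested
by the lower process of an edge only. The counting clauses follow the request of a lower process
`p` for the fork of a higher process `q`, and the fork itself while it is away from `q`. -/
structure ForkInv (x : State P) : Prop where
  need_sub : ∀ p q, q ∈ x.need p → x.pc p = 14 ∧ q ∈ x.nbh p
  req_lt : ∀ p q, 0 < x.req p q → p < q
  prom_lt : ∀ p q, p ∈ x.prom q → p < q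
  need_count : ∀ p q, p < q →
    x.req p q + (if p ∈ x.prom q then 1 else 0) + x.gra q p = if q ∈ x.need p then 1 else 0
  away_count : ∀ p q, p < q →
    (if p ∈ x.away q then 1 else 0) =
      x.gra q p + (if 14 ≤ x.pc p ∧ q ∈ x.nbh p ∧ q ∉ x.need p then 1 else 0) + x.gra p q
  need_away : ∀ p q, q < p → q ∈ x.need p → q ∈ x.away p

theorem priorityInv_of_mem_init (h : x ∈ init) : PriorityInv x := by
  obtain ⟨h1, h2, -, h4⟩ := h
  constructor <;> simp [h1, h2, h4]

theorem forkInv_of_mem_init (h : x ∈ init) : ForkInv x := by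
  obtain ⟨-, h2, -, h4⟩ := h
  constructor <;> simp [h2, h4]

set_option maxHeartbeats 2000000 in
theorem PriorityInv.step (hx : PriorityInv x) (h : step AE x y) : PriorityInv y := by
  obtain ⟨i1, i2, i3, i4, i5⟩ := hx
  -- in order: the stuttering step, the environment steps at lines 11 to 14, the forward steps at
  -- lines 12 to 16, and the receiving steps in the order of `Msg`
  rcases h with rfl | ⟨s, (h | h | h | h) | (h | h | h | h | h) |
    ⟨t, _ | _ | _ | _ | _ | _ | _, h⟩⟩
  · constructor <;> assumption
  · obtain ⟨h1, S, h2, rfl⟩ := h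
    constructor <;> first | assumption | grind [Function.update_apply, incr, decr, higher]
  iterate 2
    · obtain ⟨h1, h2, rfl⟩ := h
      constructor <;> first | assumption | grind [Function.update_apply, incr, decr, higher]
  · obtain ⟨h1, h2, h3, rfl⟩ := h
    constructor <;> first | assumption | grind [Function.update_apply, incr, decr, higher]
  iterate 3
    · obtain ⟨h1, h2, rfl⟩ := h
      constructor <;> first | assumption | grind [Function.update_apply, incr, decr, higher]
  iterate 2
    · obtain ⟨h1, rfl⟩ := h
      constructor <;> first | assumption | grind [Function.update_apply, incr, decr, higher]
  iterate 6
    · obtain ⟨h1, rfl⟩ := h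
      constructor <;> first
        | assumption
        | grind (splits := 30) [Function.update_apply, incr, decr, higher]
  · obtain ⟨h1, h2, rfl⟩ := h
    constructor <;> assumption

set_option maxHeartbeats 2000000 in
theorem ForkInv.step (hx : ForkInv x) (h : step AE x y) : ForkInv y := by
  obtain ⟨i1, i2, i3, i4, i5, i6⟩ := hx
  rcases h with rfl | ⟨s, (h | h | h | h) | (h | h | h | h | h) |
    ⟨t, _ | _ | _ | _ | _ | _ | _, h⟩⟩
  · constructor <;> assumption
  · obtain ⟨h1, S, h2, rfl⟩ := h
    constructor <;> first | assumption | grind [Function.update_apply, incr, decr, higher]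
  iterate 2
    · obtain ⟨h1, h2, rfl⟩ := h
      constructor <;> first | assumption | grind [Function.update_apply, incr, decr, higher]
  · obtain ⟨h1, h2, h3, rfl⟩ := h
    constructor <;> first | assumption | grind [Function.update_apply, incr, decr, higher]
  iterate 3
    · obtain ⟨h1, h2, rfl⟩ := h
      constructor <;> first | assumption | grind [Function.update_apply, incr, decr, higher]
  iterate 2
    · obtain ⟨h1, rfl⟩ := h
      constructor <;> first | assumption | grind [Function.update_apply, incr, decr, higher]
  iterate 6
    · obtain ⟨h1, rfl⟩ := h
      constructor <;> first
        | assumption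
        | grind (splits := 30) [Function.update_apply, incr, decr, higher]
  · obtain ⟨h1, h2, rfl⟩ := h
    constructor <;> first
      | assumption
      | grind (splits := 30) [Function.update_apply, incr, decr, higher]

/-! ### Single steps -/

/-- `m` has arrived at `p` from `q`. For the internal steps `after` and `prom`, this is the part of
the guard that the other steps cannot falsify. -/
def Ready (m : Msg) (q p : P) (x : State P) : Prop :=
  match m with
  | .notify => 0 < x.notify q p
  | .withdraw => 0 < x.withdraw q p
  | .after => q ∈ x.after p ∩ x.before p
  | .ack => 0 < x.ack q p
  | .req => 0 < x.req q p
  | .gra => 0 < x.gra q p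
  | .prom => q ∈ x.prom p \ x.away p

set_option maxHeartbeats 1000000 in
/-- An available message stays available until it is received. -/
theorem Ready.step {m : Msg} (hm : Ready m q p x) (h : step AE x y) :
    recv m q p x y ∨ Ready m q p y := by
  rcases h with rfl | ⟨s, (⟨h1, S, h2, rfl⟩ | ⟨h1, h2, rfl⟩ | ⟨h1, h2, rfl⟩ | ⟨h1, h2, h3, rfl⟩) |
    (⟨h1, h2, rfl⟩ | ⟨h1, h2, rfl⟩ | ⟨h1, h2, rfl⟩ | ⟨h1, rfl⟩ | ⟨h1, rfl⟩) | ⟨t, m', h⟩⟩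
  · exact .inr hm
  iterate 9 · cases m <;> grind [Ready, incr]
  by_cases hst : s = p ∧ t = q ∧ m' = m
  · obtain ⟨rfl, rfl, rfl⟩ := hst
    exact .inl h
  right
  cases m'
  iterate 6
    · obtain ⟨h1, rfl⟩ := h
      cases m <;> grind [Ready, incr, decr, Function.update_apply]
  · obtain ⟨h1, h2, rfl⟩ := h
    cases m <;> grind [Ready, incr, decr, Function.update_apply]

theorem pc_le_of_step (h : step AE x y) (hy : y.pc p ≠ 11) : x.pc p ≤ y.pc p := by
  rcases h with rfl | ⟨s, (⟨h1, S, h2, rfl⟩ | ⟨h1, h2, rfl⟩ | ⟨h1, h2, rfl⟩ | ⟨h1, h2, h3, rfl⟩) |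
    (⟨h1, h2, rfl⟩ | ⟨h1, h2, rfl⟩ | ⟨h1, h2, rfl⟩ | ⟨h1, rfl⟩ | ⟨h1, rfl⟩) | ⟨t, m', h⟩⟩
  iterate 10 · grind [higher, Function.update_apply]
  cases m'
  iterate 6
    · obtain ⟨h1, rfl⟩ := h
      grind [higher, Function.update_apply]
  · obtain ⟨h1, h2, rfl⟩ := h
    grind [higher, Function.update_apply]

theorem nbh_eq_of_step (h : step AE x y) (hx : x.pc p ≠ 11) (hy : y.pc p ≠ 11) :
    y.nbh p = x.nbh p := by
  rcases h with rfl | ⟨s, (⟨h1, S, h2, rfl⟩ | ⟨h1, h2, rfl⟩ | ⟨h1, h2, rfl⟩ | ⟨h1, h2, h3, rfl⟩) |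
    (⟨h1, h2, rfl⟩ | ⟨h1, h2, rfl⟩ | ⟨h1, h2, rfl⟩ | ⟨h1, rfl⟩ | ⟨h1, rfl⟩) | ⟨t, m', h⟩⟩
  iterate 10 · grind [higher, Function.update_apply]
  cases m'
  iterate 6
    · obtain ⟨h1, rfl⟩ := h
      grind [higher, Function.update_apply]
  · obtain ⟨h1, h2, rfl⟩ := h
    grind [higher, Function.update_apply]

theorem notMem_wack_of_step (h : step AE x y) (hy : y.pc p = 12) (hq : q ∉ x.wack p) :
    q ∉ y.wack p := by
  rcases h with rfl | ⟨s, (⟨h1, S, h2, rfl⟩ | ⟨h1, h2, rfl⟩ | ⟨h1, h2, rfl⟩ | ⟨h1, h2, h3, rfl⟩) |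
    (⟨h1, h2, rfl⟩ | ⟨h1, h2, rfl⟩ | ⟨h1, h2, rfl⟩ | ⟨h1, rfl⟩ | ⟨h1, rfl⟩) | ⟨t, m', h⟩⟩
  iterate 10 · grind [higher, Function.update_apply]
  cases m'
  iterate 6
    · obtain ⟨h1, rfl⟩ := h
      grind [higher, Function.update_apply]
  · obtain ⟨h1, h2, rfl⟩ := h
    grind [higher, Function.update_apply]

theorem notMem_prio_of_step (h : step AE x y) (hx : x.pc p = 13) (hy : y.pc p = 13)
    (hq : q ∉ x.prio p) :
    q ∉ y.prio p := by
  rcases h with rfl | ⟨s, (⟨h1, S, h2, rfl⟩ | ⟨h1, h2, rfl⟩ | ⟨h1, h2, rfl⟩ | ⟨h1, h2, h3, rfl⟩) |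
    (⟨h1, h2, rfl⟩ | ⟨h1, h2, rfl⟩ | ⟨h1, h2, rfl⟩ | ⟨h1, rfl⟩ | ⟨h1, rfl⟩) | ⟨t, m', h⟩⟩
  iterate 10 · grind [higher, Function.update_apply]
  cases m'
  iterate 6
    · obtain ⟨h1, rfl⟩ := h
      grind [higher, Function.update_apply]
  · obtain ⟨h1, h2, rfl⟩ := h
    grind [higher, Function.update_apply]

theorem notMem_need_of_step (h : step AE x y) (hx : x.pc p = 14) (hy : y.pc p = 14)
    (hq : q ∉ x.need p) (hprom : q ∉ x.prom p) :
    q ∉ y.need p := by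
  rcases h with rfl | ⟨s, (⟨h1, S, h2, rfl⟩ | ⟨h1, h2, rfl⟩ | ⟨h1, h2, rfl⟩ | ⟨h1, h2, h3, rfl⟩) |
    (⟨h1, h2, rfl⟩ | ⟨h1, h2, rfl⟩ | ⟨h1, h2, rfl⟩ | ⟨h1, rfl⟩ | ⟨h1, rfl⟩) | ⟨t, m', h⟩⟩
  iterate 10 · grind [higher, Function.update_apply]
  cases m'
  iterate 6
    · obtain ⟨h1, rfl⟩ := h
      grind [higher, Function.update_apply]
  · obtain ⟨h1, h2, rfl⟩ := h
    grind [higher, Function.update_apply]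

theorem notMem_away_of_step (h : step AE x y) (hq : q ∉ x.away p) (hprom : q ∉ x.prom p) :
    q ∉ y.away p := by
  rcases h with rfl | ⟨s, (⟨h1, S, h2, rfl⟩ | ⟨h1, h2, rfl⟩ | ⟨h1, h2, rfl⟩ | ⟨h1, h2, h3, rfl⟩) |
    (⟨h1, h2, rfl⟩ | ⟨h1, h2, rfl⟩ | ⟨h1, h2, rfl⟩ | ⟨h1, rfl⟩ | ⟨h1, rfl⟩) | ⟨t, m', h⟩⟩
  iterate 10 · grind [higher, Function.update_apply]
  cases m'
  iterate 6
    · obtain ⟨h1, rfl⟩ := h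
      grind [higher, Function.update_apply]
  · obtain ⟨h1, h2, rfl⟩ := h
    grind [higher, Function.update_apply]

theorem mem_before_of_step (h : step AE x y) (hb : q ∈ x.before p) (ha : q ∉ x.after p) :
    q ∈ y.before p := by
  rcases h with rfl | ⟨s, (⟨h1, S, h2, rfl⟩ | ⟨h1, h2, rfl⟩ | ⟨h1, h2, rfl⟩ | ⟨h1, h2, h3, rfl⟩) |
    (⟨h1, h2, rfl⟩ | ⟨h1, h2, rfl⟩ | ⟨h1, h2, rfl⟩ | ⟨h1, rfl⟩ | ⟨h1, rfl⟩) | ⟨t, m', h⟩⟩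
  iterate 10 · grind [higher, Function.update_apply]
  cases m'
  iterate 6
    · obtain ⟨h1, rfl⟩ := h
      grind [higher, Function.update_apply]
  · obtain ⟨h1, h2, rfl⟩ := h
    grind [higher, Function.update_apply]

theorem mem_after_of_step (h : step AE x y) (ha : q ∈ x.after p) :
    recv .after q p x y ∨ q ∈ y.after p := by
  rcases h with rfl | ⟨s, (⟨h1, S, h2, rfl⟩ | ⟨h1, h2, rfl⟩ | ⟨h1, h2, rfl⟩ | ⟨h1, h2, h3, rfl⟩) |
    (⟨h1, h2, rfl⟩ | ⟨h1, h2, rfl⟩ | ⟨h1, h2, rfl⟩ | ⟨h1, rfl⟩ | ⟨h1, rfl⟩) | ⟨t, m', h⟩⟩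
  iterate 10 · grind [recv, Function.update_apply]
  cases m'
  iterate 6
    · obtain ⟨h1, rfl⟩ := h
      grind [recv, Function.update_apply]
  · obtain ⟨h1, h2, rfl⟩ := h
    grind [recv, Function.update_apply]

theorem mem_prom_of_step (h : step AE x y) (hq : q ∈ x.prom p) :
    recv .prom q p x y ∨ q ∈ y.prom p := by
  rcases h with rfl | ⟨s, (⟨h1, S, h2, rfl⟩ | ⟨h1, h2, rfl⟩ | ⟨h1, h2, rfl⟩ | ⟨h1, h2, h3, rfl⟩) |
    (⟨h1, h2, rfl⟩ | ⟨h1, h2, rfl⟩ | ⟨h1, h2, rfl⟩ | ⟨h1, rfl⟩ | ⟨h1, rfl⟩) | ⟨t, m', h⟩⟩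
  iterate 10 · grind [recv, Function.update_apply]
  cases m'
  iterate 6
    · obtain ⟨h1, rfl⟩ := h
      grind [recv, Function.update_apply]
  · obtain ⟨h1, h2, rfl⟩ := h
    grind [recv, Function.update_apply]

/-- `p` does not compete with `q` beyond line 13: if `p` has `q` as a neighbour then `p` has not yet
decided on its priorities, or it waits at line 13 for `q`. -/
def Yields (q p : P) (x : State P) : Prop :=
  q ∈ x.nbh p → x.pc p ≤ 12 ∨ x.pc p = 13 ∧ q ∈ x.prio p

/-- While the notification of `q` is recorded at `p` and no withdrawal of `q` is on its way, `p`
gives priority to `q` when it passes line 12, and then it cannot pass line 13. -/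
theorem Yields.step (h : step AE x y) (hx : Yields q p x) (hb : q ∈ x.before p) (ha : q ∉ x.after p)
    (hw : x.withdraw q p = 0) :
    Yields q p y := by
  rcases h with rfl | ⟨s, (⟨h1, S, h2, rfl⟩ | ⟨h1, h2, rfl⟩ | ⟨h1, h2, rfl⟩ | ⟨h1, h2, h3, rfl⟩) |
    (⟨h1, h2, rfl⟩ | ⟨h1, h2, rfl⟩ | ⟨h1, h2, rfl⟩ | ⟨h1, rfl⟩ | ⟨h1, rfl⟩) | ⟨t, m', h⟩⟩
  iterate 10 · grind [Yields, Function.update_apply]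
  cases m'
  iterate 6
    · obtain ⟨h1, rfl⟩ := h
      grind [Yields, Function.update_apply]
  · obtain ⟨h1, h2, rfl⟩ := h
    grind [Yields, Function.update_apply]

/-! ### Executions -/

theorem step_of_mem_Ex (h : xs ∈ Ex AE) (n : ℕ) : step AE (xs n) (xs (n + 1)) := by
  simpa [box, sem₂, shift] using h.2 n

theorem priorityInv_of_mem_Ex (h : xs ∈ Ex AE) (n : ℕ) : PriorityInv (xs n) := by
  induction n with
  | zero => exact priorityInv_of_mem_init h.1
  | succ n ih => exact ih.step (step_of_mem_Ex h n)

theorem forkInv_of_mem_Ex (h : xs ∈ Ex AE) (n : ℕ) : ForkInv (xs n) := by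
  induction n with
  | zero => exact forkInv_of_mem_init h.1
  | succ n ih => exact ih.step (step_of_mem_Ex h n)

theorem exists_recv (h : xs ∈ Ex AE) {m : Msg} (hm : m ≠ .prom) (hw : xs ∈ wf (recv m q p))
    {n : ℕ} (hn : Ready m q p (xs n)) : ∃ k ≥ n, recv m q p (xs k) (xs (k + 1)) := by
  refine exists_step_of_wf hw hn (fun k _ hk => hk.step (step_of_mem_Ex h k)) fun k _ hk hd => ?_
  cases m
  case prom => exact hm rfl
  all_goals exact hd _ ⟨hk, rfl⟩

/-- The counterpart of `exists_recv` for `prom`. Its guard also demands that `p` is not beyond line 14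
with `q` as a neighbour; as steps of `p` can falsify this, it is assumed to hold permanently. -/
theorem exists_recv_prom (h : xs ∈ Ex AE) (hw : xs ∈ wf (recv .prom q p)) {n : ℕ}
    (hn : Ready .prom q p (xs n)) (hg : ∀ k ≥ n, ¬ (15 ≤ (xs k).pc p ∧ q ∈ (xs k).nbh p)) :
    ∃ k ≥ n, recv .prom q p (xs k) (xs (k + 1)) :=
  exists_step_of_wf hw hn (fun k _ hk => hk.step (step_of_mem_Ex h k))
    fun k hkn hk hd => hd _ ⟨hk, hg k hkn, rfl⟩

/-! ### Waiting at lines 12 and 13 -/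

/-- A process does not wait forever at line 12: each of its withdrawals is eventually
acknowledged. -/
theorem exists_notMem_wack (h : xs ∈ Ex AE)
    (hw : ∀ m, xs ∈ wf (recv m q p) ∧ xs ∈ wf (recv m p q)) (N : ℕ) :
    ∃ n ≥ N, q ∉ (xs n).wack p := by
  by_contra! hwack
  have hcount : ∀ n ≥ N, (xs n).withdraw p q + (if p ∈ (xs n).after q then 1 else 0) +
      (xs n).ack q p = 1 := fun n hn => by
    simpa [hwack n hn] using (priorityInv_of_mem_Ex h n).wack_count p q
  have hack : ∀ n ≥ N, ¬ Ready .ack q p (xs n) := fun n hn hr => by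
    obtain ⟨k, hk, -, hy⟩ := exists_recv h (by simp) (hw .ack).1 hr
    exact absurd (hwack (k + 1) (by omega)) (by simp [hy])
  have hboth : ∀ n ≥ N, ¬ recv .after p q (xs n) (xs (n + 1)) := fun n hn hr =>
    hack (n + 1) (by omega) (by simp [Ready, hr.2, incr])
  obtain ⟨n, hn, ha⟩ : ∃ n ≥ N, p ∈ (xs n).after q := by
    by_cases ha : p ∈ (xs N).after q
    · exact ⟨N, le_rfl, ha⟩
    · have hN := hcount N le_rfl
      have hN' := hack N le_rfl
      simp only [Ready, ha] at hN hN'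
      obtain ⟨k, hk, -, hy⟩ := exists_recv (m := .withdraw) (n := N) h (by simp) (hw .withdraw).2
        (by simp only [Ready]; simp at hN; omega)
      exact ⟨k + 1, by omega, by simp [hy]⟩
  have ha' : ∀ k ≥ n, p ∈ (xs k).after q := fun k hk =>
    Nat.le_induction ha (fun k hk hk' => (mem_after_of_step (step_of_mem_Ex h k) hk').resolve_left
      (hboth k (by omega))) k hk
  obtain ⟨k, hk, hb⟩ : ∃ k ≥ n, p ∈ (xs k).before q := by
    by_cases hb : p ∈ (xs n).before q
    · exact ⟨n, le_rfl, hb⟩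
    · have hc := (priorityInv_of_mem_Ex h n).before_count p q
      simp only [ha, hb] at hc
      obtain ⟨k, hk, -, hy⟩ := exists_recv (m := .notify) (n := n) h (by simp) (hw .notify).2
        (by simp only [Ready]; simp at hc; omega)
      exact ⟨k + 1, by omega, by simp [hy]⟩
  obtain ⟨l, hl, hr⟩ := exists_recv h (by simp) (hw .after).2
    (show Ready .after p q (xs k) by simp [Ready, ha' k hk, hb])
  exact hboth l (by omega) hr

/-- A process that waits forever at line 13 because of the priority of `q` is in conflict with `q`:
otherwise `q` would withdraw. -/
theorem conflict_of_mem_prio (h : xs ∈ Ex AE) (hw : ∀ m, xs ∈ wf (recv m q p)) {N : ℕ}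
    (hq : ∀ n ≥ N, q ∈ (xs n).prio p) : ∀ n ≥ N, xs n ∈ conflict p q := by
  intro n hn
  have hinv := priorityInv_of_mem_Ex h n
  obtain ⟨-, hnbh, hb, ha⟩ := hinv.prio_sub p q (hq n hn)
  refine ⟨hnbh, ?_⟩
  by_contra hp
  have hc := hinv.before_count q p
  simp only [hp, hb, ha] at hc
  obtain ⟨k, hk, -, hy⟩ := exists_recv (m := .withdraw) (n := n) h (by simp) (hw .withdraw)
    (by simp only [Ready]; simp at hc; omega)
  exact absurd (hq (k + 1) (by omega)) (by simp [hy])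

/-! ### Waiting at line 14 -/

/-- If `p` stays at line 14, each neighbour `q` of `p` eventually knows of `p`. Then, if `q` ever
yields to `p`, it does so forever. -/
theorem yields_or_mem_nbh (h : xs ∈ Ex AE) (hw : ∀ m, xs ∈ wf (recv m p q)) {N : ℕ}
    (hpc : ∀ n ≥ N, (xs n).pc p = 14) (hnbh : ∀ n ≥ N, q ∈ (xs n).nbh p) :
    ∃ M ≥ N, (∀ n ≥ M, Yields p q (xs n)) ∨ ∀ n ≥ M, p ∈ (xs n).nbh q := by
  have hwa : ∀ n ≥ N, (xs n).withdraw p q = 0 ∧ p ∉ (xs n).after q := fun n hn => by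
    have hinv := priorityInv_of_mem_Ex h n
    have hc := hinv.wack_count p q
    rw [hinv.wack_empty p (.inr (hpc n hn))] at hc
    grind
  obtain ⟨M, hM, hb⟩ : ∃ M ≥ N, p ∈ (xs M).before q := by
    by_cases hb : p ∈ (xs N).before q
    · exact ⟨N, le_rfl, hb⟩
    · have hc := (priorityInv_of_mem_Ex h N).before_count p q
      simp only [hpc N le_rfl, hnbh N le_rfl, hb] at hc
      obtain ⟨k, hk, -, hy⟩ := exists_recv (m := .notify) (n := N) h (by simp) (hw .notify)
        (by simp only [Ready]; simp at hc; omega)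
      exact ⟨k + 1, by omega, by simp [hy]⟩
  have hb' : ∀ n ≥ M, p ∈ (xs n).before q := fun n hn =>
    Nat.le_induction hb (fun k hk hk' => mem_before_of_step (step_of_mem_Ex h k) hk'
      (hwa k (by omega)).2) n hn
  by_cases hY : ∃ K ≥ M, Yields p q (xs K)
  · obtain ⟨K, hK, hY⟩ := hY
    refine ⟨K, by omega, .inl fun n hn => Nat.le_induction hY (fun k hk hk' => ?_) n hn⟩
    exact hk'.step (step_of_mem_Ex h k) (hb' k (by omega)) (hwa k (by omega)).2
      (hwa k (by omega)).1
  · push Not at hY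
    refine ⟨M, hM, .inr fun n hn => ?_⟩
    by_contra hp
    exact hY n hn fun hp' => absurd hp' hp

/-- A higher process that yields to `p` grants its fork to `p`. -/
theorem exists_notMem_need_of_lt (h : xs ∈ Ex AE)
    (hw : ∀ m, xs ∈ wf (recv m q p) ∧ xs ∈ wf (recv m p q)) (hpq : p < q) {N : ℕ}
    (hY : ∀ n ≥ N, Yields p q (xs n)) : ∃ n ≥ N, q ∉ (xs n).need p := by
  by_contra! hneed
  have hgra : ∀ n ≥ N, ¬ Ready .gra q p (xs n) := fun n hn hr => by
    obtain ⟨k, hk, -, hy⟩ := exists_recv h (by simp) (hw .gra).1 hr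
    exact absurd (hneed (k + 1) (by omega)) (by simp [hy])
  have hno : ∀ n ≥ N, ¬ recv .prom p q (xs n) (xs (n + 1)) := fun n hn hr =>
    hgra (n + 1) (by omega) (by simp [Ready, hr.2.2, incr])
  have hprom : ∃ n ≥ N, p ∈ (xs n).prom q := by
    by_cases hp : p ∈ (xs N).prom q
    · exact ⟨N, le_rfl, hp⟩
    · have hc := (forkInv_of_mem_Ex h N).need_count p q hpq
      have hg := hgra N le_rfl
      simp only [hp, hneed N le_rfl, Ready] at hc hg
      obtain ⟨k, hk, -, hy⟩ := exists_recv (m := .req) (n := N) h (by simp) (hw .req).2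
        (by simp only [Ready]; simp at hc; omega)
      exact ⟨k + 1, by omega, by simp [hy]⟩
  obtain ⟨n, hn, hp⟩ := hprom
  have hp' : ∀ k ≥ n, p ∈ (xs k).prom q := fun k hk =>
    Nat.le_induction hp (fun k hk hk' => (mem_prom_of_step (step_of_mem_Ex h k) hk').resolve_left
      (hno k (by omega))) k hk
  obtain ⟨k, hk, ha⟩ : ∃ k ≥ n, p ∉ (xs k).away q := by
    by_cases ha : p ∈ (xs n).away q
    · have hc := (forkInv_of_mem_Ex h n).away_count p q hpq
      have hg := hgra n hn
      simp only [ha, hneed n hn, Ready] at hc hg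
      obtain ⟨k, hk, -, hy⟩ := exists_recv (m := .gra) (n := n) h (by simp) (hw .gra).2
        (by simp only [Ready]; simp at hc; omega)
      exact ⟨k + 1, by omega, by simp [hy]⟩
    · exact ⟨n, le_rfl, ha⟩
  obtain ⟨l, hl, hr⟩ := exists_recv_prom h (hw .prom).2
    (show Ready .prom p q (xs k) by simp [Ready, hp' k hk, ha]) fun l hl hg => by
      have := hY l (by omega) hg.2
      omega
  exact hno l (by omega) hr

/-- A lower process that yields to `p` returns the fork of `p`, and does not request it again. -/
theorem eventually_notMem_need_of_gt (h : xs ∈ Ex AE) (hw : ∀ m, xs ∈ wf (recv m q p))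
    (hqp : q < p) {N : ℕ} (hY : ∀ n ≥ N, Yields p q (xs n)) :
    ∃ n ≥ N, ∀ k ≥ n, q ∉ (xs k).need p := by
  have hF : ∀ n ≥ N, q ∉ (xs n).prom p ∧ (q ∈ (xs n).away p → 0 < (xs n).gra q p) := by
    intro n hn
    have hinv := forkInv_of_mem_Ex h n
    have hYn := hY n hn
    have hneed : p ∉ (xs n).need q := fun hp => by
      have h1 := hinv.need_sub q p hp
      have h2 := hYn h1.2
      omega
    have hpc : ¬ (14 ≤ (xs n).pc q ∧ p ∈ (xs n).nbh q ∧ p ∉ (xs n).need q) := fun hp => by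
      have h2 := hYn hp.2.1
      omega
    have h1 := hinv.need_count q p hqp
    have h2 := hinv.away_count q p hqp
    grind
  obtain ⟨n, hn, ha⟩ : ∃ n ≥ N, q ∉ (xs n).away p := by
    by_cases ha : q ∈ (xs N).away p
    · obtain ⟨k, hk, -, hy⟩ := exists_recv (m := .gra) h (by simp) (hw .gra) ((hF N le_rfl).2 ha)
      exact ⟨k + 1, by omega, by simp [hy]⟩
    · exact ⟨N, le_rfl, ha⟩
  refine ⟨n, hn, fun k hk hq => ?_⟩
  refine Nat.le_induction ha (fun k hk hk' => ?_) k hk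
    ((forkInv_of_mem_Ex h k).need_away p q hqp hq)
  exact notMem_away_of_step (step_of_mem_Ex h k) hk' (hF k (by omega)).1

/-- A process that waits forever at line 14 is in conflict forever with any `q` that
it needs infinitely often. -/
theorem conflict_of_frequently_mem_need (h : xs ∈ Ex AE)
    (hw : ∀ m, xs ∈ wf (recv m q p) ∧ xs ∈ wf (recv m p q)) {N : ℕ}
    (hpc : ∀ n ≥ N, (xs n).pc p = 14) (hnbh : ∀ n ≥ N, q ∈ (xs n).nbh p)
    (hneed : ∃ᶠ n in atTop, q ∈ (xs n).need p) : ∃ M, ∀ n ≥ M, xs n ∈ conflict p q := by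
  obtain ⟨M, hM, hY | hc⟩ := yields_or_mem_nbh h (fun m => (hw m).2) hpc hnbh
  · exfalso
    rcases lt_trichotomy p q with hpq | rfl | hqp
    · obtain ⟨n, hn, hq⟩ := exists_notMem_need_of_lt h hw hpq hY
      refine hq (mem_of_frequently_mem (S := fun n => (xs n).need p) (N := N) (fun k hk hk' => ?_)
        hneed n (hM.trans hn))
      -- only lower processes send requests, so that `q` does not enter `need` at line 14
      exact notMem_need_of_step (step_of_mem_Ex h k) (hpc k hk) (hpc (k + 1) (by omega)) hk'
        fun hq => lt_asymm hpq ((forkInv_of_mem_Ex h k).prom_lt q p hq)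
    · -- a process at line 14 does not yield to itself
      have := hY M le_rfl (hnbh M hM)
      have := hpc M hM
      omega
    · obtain ⟨n, -, hn⟩ := eventually_notMem_need_of_gt h (fun m => (hw m).1) hqp hY
      obtain ⟨k, hk, hq⟩ := frequently_atTop.1 hneed n
      exact hn k hk hq
  · exact ⟨M, fun n hn => ⟨hnbh n (by omega), hc n hn⟩⟩

/-! ### Maximal concurrency -/

/-- A process that is no longer idle from time `N` onward is eventually stuck at one line, because
all its steps except those to line 11 go forward. -/
theorem exists_pc_eq (h : xs ∈ Ex AE) {N : ℕ} (hN : ∀ n ≥ N, (xs n).pc p ≠ 11) :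
    ∃ M ≥ N, ∀ n ≥ M, (xs n).pc p = (xs M).pc p := by
  have hmono : ∀ m ≥ N, ∀ n ≥ m, (xs m).pc p ≤ (xs n).pc p := fun m hm n hn =>
    Nat.le_induction le_rfl (fun k hk hle => hle.trans
      (pc_le_of_step (step_of_mem_Ex h k) (hN (k + 1) (by omega)))) n hn
  let f : ℕ → ℕ := fun n => 16 - (xs (N + n)).pc p
  refine ⟨N + Function.argmin f, by omega, fun n hn => ?_⟩
  have h1 := hmono _ (by omega) n hn
  have h2 : f (Function.argmin f) ≤ f (n - N) := Function.argmin_le f _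
  simp only [f, show N + (n - N) = n by omega] at h2
  have h3 := ((priorityInv_of_mem_Ex h n).pc_mem p).2
  have h4 := ((priorityInv_of_mem_Ex h (N + Function.argmin f)).pc_mem p).2
  simp only [f] at *
  omega

/-- A process that is stuck at one line is blocked infinitely often by the guard of its forward
step, as that step would move it to another line. -/
theorem frequently_disabled_fwd (hw : xs ∈ wf (fwd p)) {M : ℕ}
    (hM : ∀ n ≥ M, (xs n).pc p = (xs M).pc p) : ∃ᶠ n in atTop, xs n ∈ disabled (fwd p) := by
  refine hw.elim mem_box_dia_sem.1 fun hs => ?_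
  obtain ⟨n, hn, hf⟩ := frequently_atTop.1 (mem_box_dia_sem₂.1 hs) M
  have h1 : (xs (n + 1)).pc p = (xs n).pc p := by rw [hM n hn, hM (n + 1) (by omega)]
  rcases hf with ⟨h, -, hy⟩ | ⟨h, -, hy⟩ | ⟨h, -, hy⟩ | ⟨h, hy⟩ | ⟨h, hy⟩ <;> simp [hy, h] at h1

theorem pc_of_disabled_fwd (hx : PriorityInv x) (h11 : x.pc p ≠ 11)
    (h : x ∈ disabled (fwd p)) :
    x.pc p = 12 ∧ (x.wack p).Nonempty ∨ x.pc p = 13 ∧ (x.prio p).Nonempty ∨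
      x.pc p = 14 ∧ (x.need p).Nonempty := by
  have hpc := hx.pc_mem p
  simp only [Finset.nonempty_iff_ne_empty]
  by_contra! hno
  obtain h12 | h13 | h14 | h15 | h16 : x.pc p = 12 ∨ x.pc p = 13 ∨ x.pc p = 14 ∨ x.pc p = 15 ∨
    x.pc p = 16 := by omega
  · exact h _ (.inl ⟨h12, hno.1 h12, rfl⟩)
  · exact h _ (.inr (.inl ⟨h13, hno.2.1 h13, rfl⟩))
  · exact h _ (.inr (.inr (.inl ⟨h14, hno.2.2 h14, rfl⟩)))
  · exact h _ (.inr (.inr (.inr (.inl ⟨h15, rfl⟩))))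
  · exact h _ (.inr (.inr (.inr (.inr ⟨h16, rfl⟩))))

theorem Wf_subset (AE : Set P) (p : P) :
    Wf AE p ⊆ box (dia (sem (at_ p 11))) ∪ ⋃ q : P, dia (box (sem (conflict p q))) := by
  rintro xs ⟨⟨h, hfwd⟩, hrec⟩
  have hw : ∀ q m, xs ∈ wf (recv m q p) ∧ xs ∈ wf (recv m p q) := fun q m =>
    Set.mem_iInter.1 (Set.mem_iInter.1 hrec q) m
  rw [Set.mem_union, mem_box_dia_sem, or_iff_not_imp_left, Set.mem_iUnion]
  simp only [mem_dia_box_sem]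
  intro h11
  obtain ⟨N, hN⟩ := eventually_atTop.1 (not_frequently.1 h11)
  replace hN : ∀ n ≥ N, (xs n).pc p ≠ 11 := hN
  obtain ⟨M, hM, hpc⟩ := exists_pc_eq h hN
  have hdis := frequently_disabled_fwd hfwd hpc
  have hblock : ∃ᶠ n in atTop, (xs M).pc p = 12 ∧ ((xs n).wack p).Nonempty ∨
      (xs M).pc p = 13 ∧ ((xs n).prio p).Nonempty ∨
      (xs M).pc p = 14 ∧ ((xs n).need p).Nonempty := by
    refine (hdis.and_eventually (eventually_ge_atTop M)).mono fun n hn => ?_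
    rw [← hpc n hn.2]
    exact pc_of_disabled_fwd (priorityInv_of_mem_Ex h n) (hN n (hM.trans hn.2)) hn.1
  simp only [frequently_or_distrib, frequently_and_distrib_left] at hblock
  rcases hblock with ⟨hl, hs⟩ | ⟨hl, hs⟩ | ⟨hl, hs⟩ <;> rw [hl] at hpc
  · obtain ⟨q, hq⟩ := exists_forall_mem (S := fun n => (xs n).wack p) (N := M) (fun n hn q =>
      notMem_wack_of_step (step_of_mem_Ex h n) (hpc (n + 1) (by omega))) hs
    obtain ⟨n, hn, hqn⟩ := exists_notMem_wack h (hw q) M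
    exact absurd (hq n hn) hqn
  · obtain ⟨q, hq⟩ := exists_forall_mem (S := fun n => (xs n).prio p) (N := M) (fun n hn q =>
      notMem_prio_of_step (step_of_mem_Ex h n) (hpc n hn) (hpc (n + 1) (by omega))) hs
    exact ⟨q, M, conflict_of_mem_prio h (fun m => (hw q m).1) hq⟩
  · have hnbh : ∀ n ≥ M, (xs n).nbh p = (xs M).nbh p := fun n hn =>
      Nat.le_induction rfl (fun k hk hk' => (nbh_eq_of_step (step_of_mem_Ex h k)
        (hN k (by omega)) (hN (k + 1) (by omega))).trans hk') n hn
    have hsub : ∀ n ≥ M, (xs n).need p ⊆ (xs M).nbh p := fun n hn q hq => by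
      rw [← hnbh n hn]
      exact ((forkInv_of_mem_Ex h n).need_sub p q hq).2
    obtain ⟨q, hq⟩ := exists_frequently_mem (eventually_atTop.2 ⟨M, hsub⟩) hs
    obtain ⟨n, hn, hqn⟩ := frequently_atTop.1 hq M
    exact ⟨q, conflict_of_frequently_mem_need h (hw q) hpc
      (fun k hk => by rw [hnbh k hk]; exact hsub n hn hqn) hq⟩

end PMX

theorem mainTheorem3 (Proc : Set ℕ) (AE : Set Proc) (p : Proc) :
    PMX.Wf AE p ⊆
      PMX.box (PMX.dia (PMX.sem (PMX.at_ p 11))) ∪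
        ⋃ q : Proc, PMX.dia (PMX.box (PMX.sem (PMX.conflict p q))) :=
  PMX.Wf_subset AE p
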